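/- Work in first-order logic with equality in the language $\{\in\}$ of set theory; $T\vdash\sigma$ means that $\sigma$ is a first-order consequence of $T$ (equivalently, by completeness, $\sigma$ holds in every model of $T$). In all schemes below, formulas may contain parameters, which are universally quantified. A formula is $\Delta_0$ if it is built from atomic formulas by propositional connectives and bounded quantifiers $\forall x\in y$, $\exists x\in y$. Let $\mathrm{Nat}(x)$ (also written $x\in\omega$) say that $x$ is transitive, linearly ordered by $\in$, and that every $y\in x\cup\{x\}$ is either $\emptyset$ or of the form $z\cup\{z\}$ with $z\in y$. Let $\mathrm{EST}$ be the theory with the axioms of Extensionality, Empty Set, Pairing, Union, Cartesian Product ($X\times Y$ is a set for all sets $X,Y$), $\Delta_0$-Separation, and the scheme of induction along $\omega$: for each formula $\varphi(x)$ that implies $x\in\omega$, if $\varphi(\emptyset)$ and $\varphi(x)\to\varphi(x\cup\{x\})$ for all $x\in\omega$, then $\varphi(x)$ for all $x\in\omega$. For a set $A$, let $L_A$ be the first-order language with equality, one unary predicate $\mathbf U$, one binary predicate $\mathbf R$, and a constant $\mathbf c_a$ for each $a\in A$. An $L_A$-structure is a quadruple $\langle M,U,R,I\rangle$ of sets with $U\subseteq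 M$, $R\subseteq M\times M$ and $I:A\to M$ a function, where $I(a)$ interprets $\mathbf c_a$. The formulas of $L_A$, satisfaction in $L_A$-structures, and $L_A$-elementary embeddings are formalized inside $\mathrm{EST}$, with formulas coded by sets and with natural numbers in the sense of $\mathrm{Nat}$. Vop\v{e}nka's Principle $\mathrm{VP}$ is the scheme stating, for each formula $\varphi(x)$ and with $X_\varphi=\{x:\varphi(x)\}$: for every set $A$, if $X_\varphi$ is a proper class (that is, $X_\varphi\neq x$ for every set $x$) all of whose members are $L_A$-structures, then there are $\mathcal M\neq\mathcal N$ in $X_\varphi$ and an $L_A$-elementary embedding $f:\mathcal M\to\mathcal N$. $\mathrm{Rep}$ (Replacement) is the scheme stating, for each formula $\varphi(x,y)$: if $\forall x\,\exists!y\,\varphi(x,y)$, then for every set $a$ the class $\{y:\exists x\in a\ \varphi(x,y)\}$ is a set. $\Delta_0$-$\mathrm{Rep}$ is its restriction to $\Delta_0$ formulas $\varphi$. Separation is the scheme stating that $\{x\in a:\varphi(x)\}$ is a set for every set $a$ and every formula $\varphi$. Theorem. (i) $\mathrm{EST}+\mathrm{VP}$ proves every instance of $\Delta_0$-$\mathrm{Rep}$.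 (ii) $\mathrm{EST}+\mathrm{VP}+\Delta_0$-$\mathrm{Rep}$ proves every instance of $\mathrm{Rep}$. (iii) Hence $\mathrm{EST}+\mathrm{VP}$ proves every instance of $\mathrm{Rep}$, and therefore also every instance of full Separation. -/

import Mathlib

namespace WeakSet

open FirstOrder FirstOrder.Language

/-! ### The language of set theory and a small toolkit for writing its formulas -/

/-- The only symbol of the language of set theory: one binary relation symbol. -/
inductive MemSymb : ℕ → Type
  | mem : MemSymb 2

/-- The language `{∈}` of set theory. -/
def LSet : FirstOrder.Language.{0, 0} := ⟨fun _ => Empty, MemSymb⟩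

/-- Formulas of the language of set theory whose free variables are indexed by `Fin n`. -/
abbrev Fm (n : ℕ) := LSet.BoundedFormula Empty n

/-- A variable stays available below a further quantifier. -/
scoped instance varCoe (n : ℕ) : Coe (Fin n) (Fin (n + 1)) := ⟨Fin.castSucc⟩

/-- `x ∈ y`. -/
def mem {n : ℕ} (x y : Fin n) : Fm n :=
  Relations.boundedFormula₂ (L := LSet) MemSymb.mem (Term.var (Sum.inr x)) (Term.var (Sum.inr y))

/-- `x = y`. -/
def eq {n : ℕ} (x y : Fin n) : Fm n :=
  Term.bdEqual (Term.var (Sum.inr x)) (Term.var (Sum.inr y))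

/-- Conjunction. -/
abbrev and {n : ℕ} (φ ψ : Fm n) : Fm n := φ ⊓ ψ

/-- Disjunction. -/
abbrev or {n : ℕ} (φ ψ : Fm n) : Fm n := φ ⊔ ψ

local infixr:69 " ⩓ " => WeakSet.and
local infixr:68 " ⩔ " => WeakSet.or

/-- `∀ x, φ x`; the bound variable is the last one of the enlarged context. -/
def all {n : ℕ} (φ : Fin (n + 1) → Fm (n + 1)) : Fm n := (φ (Fin.last n)).all

/-- `∃ x, φ x`. -/
def ex {n : ℕ} (φ : Fin (n + 1) → Fm (n + 1)) : Fm n := (φ (Fin.last n)).ex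

/-- `∀ x ∈ a, φ x`. -/
def allIn {n : ℕ} (a : Fin n) (φ : Fin (n + 1) → Fm (n + 1)) : Fm n :=
  all fun x => mem x a ⟹ φ x

/-- `∃ x ∈ a, φ x`. -/
def exIn {n : ℕ} (a : Fin n) (φ : Fin (n + 1) → Fm (n + 1)) : Fm n :=
  ex fun x => mem x a ⩓ φ x

/-- The formula `φ(p, a)`, for a formula `φ` with `k` parameter variables and `m` further free
variables, the variables being replaced by the variables `p` and `a` of the present context. -/
def inst {k m n : ℕ} (φ : LSet.Formula (Fin k ⊕ Fin m)) (p : Fin k → Fin n) (a : Fin m → Fin n) :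
    Fm n :=
  BoundedFormula.relabel (fun i => Sum.inr (Sum.elim p a i)) φ

/-- `Δ₀` formulas: built from atomic formulas by propositional connectives (`⊥` and `→`, from which
Mathlib defines the others) and bounded quantifiers `∀ x ∈ y`, `∃ x ∈ y`. -/
inductive IsDelta0 {α : Type} : ∀ {n : ℕ}, LSet.BoundedFormula α n → Prop
  | falsum {n : ℕ} : IsDelta0 (BoundedFormula.falsum : LSet.BoundedFormula α n)
  | equal {n : ℕ} (t s : LSet.Term (α ⊕ Fin n)) : IsDelta0 (BoundedFormula.equal t s)
  | rel {n l : ℕ} (R : LSet.Relations l) (ts : Fin l → LSet.Term (α ⊕ Fin n)) :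
      IsDelta0 (BoundedFormula.rel R ts)
  | imp {n : ℕ} {φ ψ : LSet.BoundedFormula α n} :
      IsDelta0 φ → IsDelta0 ψ → IsDelta0 (φ.imp ψ)
  | ball {n : ℕ} (y : α ⊕ Fin n) {φ : LSet.BoundedFormula α (n + 1)} : IsDelta0 φ →
      IsDelta0 (BoundedFormula.all
        ((Relations.boundedFormula₂ (L := LSet) MemSymb.mem (Term.var (Sum.inr (Fin.last n)))
          (Term.var (Sum.map id Fin.castSucc y))).imp φ))
  | bex {n : ℕ} (y : α ⊕ Fin n) {φ : LSet.BoundedFormula α (n + 1)} : IsDelta0 φ →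
      IsDelta0 (BoundedFormula.ex
        (Relations.boundedFormula₂ (L := LSet) MemSymb.mem (Term.var (Sum.inr (Fin.last n)))
          (Term.var (Sum.map id Fin.castSucc y)) ⊓ φ))

/-! ### Elementary set-theoretic notions -/

section Basic

variable {n : ℕ}

/-- `x ⊆ y`. -/
def isSub (x y : Fin n) : Fm n := allIn x fun w => mem w y

/-- `x = ∅`. -/
def isEmpty (x : Fin n) : Fm n := all fun w => ∼(mem w x)

/-- `z = {x, y}`. -/
def isUPair (z x y : Fin n) : Fm n := all fun w => mem w z ⇔ (eq w x ⩔ eq w y)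

/-- `z = ⟨x, y⟩ = {{x}, {x, y}}`. -/
def isPair (z x y : Fin n) : Fm n :=
  ex fun s => ex fun t => isUPair s x x ⩓ isUPair t x y ⩓ isUPair z s t

/-- `z = ⟨x₀, x₁, x₂⟩ = ⟨⟨x₀, x₁⟩, x₂⟩`. -/
def isTriple (z x₀ x₁ x₂ : Fin n) : Fm n := ex fun p => isPair p x₀ x₁ ⩓ isPair z p x₂

/-- `z = ⟨x₀, x₁, x₂, x₃⟩ = ⟨⟨x₀, x₁, x₂⟩, x₃⟩`. -/
def isQuadruple (z x₀ x₁ x₂ x₃ : Fin n) : Fm n :=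
  ex fun p => isTriple p x₀ x₁ x₂ ⩓ isPair z p x₃

/-- `P = X × Y`. -/
def isProd (P X Y : Fin n) : Fm n :=
  all fun w => mem w P ⇔ exIn X fun x => exIn Y fun y => isPair w x y

/-- `⟨x, y⟩ ∈ f`; for a function `f` this says `f(x) = y`. -/
def app (f x y : Fin n) : Fm n := exIn f fun p => isPair p x y

/-- `f` is a function with domain `X`. -/
def isFunOn (f X : Fin n) : Fm n :=
  (allIn f fun p => exIn X fun x => ex fun y => isPair p x y) ⩓
  (allIn X fun x => ex fun y => app f x y ⩓ all fun z => app f x z ⟹ eq z y)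

/-- `f` is a function from `X` to `Y`. -/
def isFunTo (f X Y : Fin n) : Fm n :=
  isFunOn f X ⩓ all fun x => all fun y => app f x y ⟹ mem y Y

/-- `f` is injective. -/
def isInj (f : Fin n) : Fm n :=
  all fun x => all fun y => all fun z => (app f x z ⩓ app f y z) ⟹ eq x y

/-- `y = x ∪ {x}`. -/
def isSuccOf (y x : Fin n) : Fm n := all fun w => mem w y ⇔ (mem w x ⩔ eq w x)

/-- `x` is a transitive set. -/
def isTrans (x : Fin n) : Fm n := allIn x fun y => allIn y fun z => mem z x

/-- `Ord(x)`: `x` is transitive and linearly ordered by membership. -/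
def isOrd (x : Fin n) : Fm n :=
  isTrans x ⩓ allIn x fun y => allIn x fun z => mem y z ⩔ eq y z ⩔ mem z y

/-- `Succ(x)`: `x = y ∪ {y}` for some `y ∈ x`. -/
def isSucc (x : Fin n) : Fm n := exIn x fun y => isSuccOf x y

/-- `Nat(x)`, that is, `x ∈ ω`; the class `ω` need not be a set. -/
def isNat (x : Fin n) : Fm n :=
  isOrd x ⩓ all fun y => (mem y x ⩔ eq y x) ⟹ (isEmpty y ⩔ isSucc y)

/-- `x ≤ y` for natural numbers. -/
def isLe (x y : Fin n) : Fm n := mem x y ⩔ eq x y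

end Basic

/-- `x` is the numeral `j`. -/
def isNum {n : ℕ} : ℕ → Fin n → Fm n
  | 0, x => isEmpty x
  | j + 1, x => ex fun y => isNum j y ⩓ isSuccOf x y

/-! ### Tuples of a length given inside the theory

The tuple `⟨x₀, …, x_{l-1}⟩` in `ˡM` is coded by iterated ordered pairs, as an element of the iterated
Cartesian product of the sets `{i} × M`: the empty tuple is `∅`, and appending the entry `x` to a
tuple `h` of length `k` gives `⟨h, ⟨k, x⟩⟩`. -/

section Tuples

variable {n : ℕ}

/-- `z = ⟨h, ⟨k, x⟩⟩`. -/
def isAppend (z h k x : Fin n) : Fm n := ex fun q => isPair q k x ⩓ isPair z h q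

/-- `p` is the function on `l + 1 = {0, …, l}` that lists the initial segments of the tuple `h` of
length `l`. -/
def isPrefixes (p l h : Fin n) : Fm n :=
  (ex fun l' => isSuccOf l' l ⩓ isFunOn p l') ⩓
  (ex fun z => isEmpty z ⩓ app p z z) ⩓
  app p l h ⩓
  allIn l fun k => ex fun k' => ex fun r => ex fun r' => ex fun x =>
    isSuccOf k' k ⩓ app p k r ⩓ app p k' r' ⩓ isAppend r' r k x

/-- `h(i) = x`, for a tuple `h` of length `l` and `i < l`. -/
def entry (l h i x : Fin n) : Fm n :=
  mem i l ⩓ ex fun p => ex fun i' => ex fun r => ex fun r' =>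
    isPrefixes p l h ⩓ isSuccOf i' i ⩓ app p i r ⩓ app p i' r' ⩓ isAppend r' r i x

/-- `h ∈ ˡM`: `h` is a tuple of length `l` with entries in `M`. -/
def isTuple (l M h : Fin n) : Fm n :=
  (ex fun p => isPrefixes p l h) ⩓ all fun i => all fun x => entry l h i x ⟹ mem x M

end Tuples

/-! ### The languages `L_A`

`L_A` has the logical symbols `≡ = 2`, `¬ = 3`, `∧ = 4`, `∃ = 5`, a unary predicate `U = 6`, a binary
predicate `R = 7`, the variables `v_i = ⟨0, i⟩` for `i ∈ ω`, and the constants `c_a = ⟨1, a⟩` for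
`a ∈ A`. -/

section Codes

variable {n : ℕ}

/-- `t` is the variable `v_i`. -/
def isVar (t i : Fin n) : Fm n := ex fun q => isNum 0 q ⩓ isPair t q i

/-- `t` is the constant `c_a`. -/
def isConst (t a : Fin n) : Fm n := ex fun q => isNum 1 q ⩓ isPair t q a

/-- `t` is a term of `L_A`. -/
def isTerm (A t : Fin n) : Fm n :=
  (ex fun i => isNat i ⩓ isVar t i) ⩔ (exIn A fun a => isConst t a)

/-- `x` is the formula `t ≡ s`. -/
def isEqCode (x t s : Fin n) : Fm n := ex fun q => isNum 2 q ⩓ isTriple x q t s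

/-- `x` is the formula `¬ y`. -/
def isNegCode (x y : Fin n) : Fm n := ex fun q => isNum 3 q ⩓ isPair x q y

/-- `x` is the formula `y ∧ z`. -/
def isAndCode (x y z : Fin n) : Fm n := ex fun q => isNum 4 q ⩓ isTriple x q y z

/-- `x` is the formula `∃ v_i y`. -/
def isExCode (x i y : Fin n) : Fm n := ex fun q => isNum 5 q ⩓ isTriple x q i y

/-- `x` is the formula `U(t)`. -/
def isUCode (x t : Fin n) : Fm n := ex fun q => isNum 6 q ⩓ isPair x q t

/-- `x` is the formula `R(t, s)`. -/
def isRCode (x t s : Fin n) : Fm n := ex fun q => isNum 7 q ⩓ isTriple x q t s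

/-- `x` is an atomic formula of `L_A`. -/
def isAFml (A x : Fin n) : Fm n :=
  (ex fun t => ex fun s => isTerm A t ⩓ isTerm A s ⩓ (isEqCode x t s ⩔ isRCode x t s)) ⩔
  (ex fun t => isTerm A t ⩓ isUCode x t)

/-- `f(r - 1) = x`. -/
def lastVal (f r x : Fin n) : Fm n := ex fun k => isSuccOf r k ⩓ app f k x

/-- `f` is a function on the natural number `r ≠ 0` with last value `x`, each of whose values is an
atomic formula of `L_A` or is obtained from earlier values by `¬`, `∧` or `∃`. -/
def isFmlSeq (A x f r : Fin n) : Fm n :=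
  isNat r ⩓ ∼(isEmpty r) ⩓ isFunOn f r ⩓ lastVal f r x ⩓
  allIn r fun k => ex fun y => app f k y ⩓
    (isAFml A y ⩔
     (exIn k fun j => ex fun u => app f j u ⩓ isNegCode y u) ⩔
     (exIn k fun j => exIn k fun j' => ex fun u => ex fun u' =>
        app f j u ⩓ app f j' u' ⩓ isAndCode y u u') ⩔
     (exIn k fun j => ex fun i => ex fun u => isNat i ⩓ app f j u ⩓ isExCode y i u))

/-- As above, with `r` minimal, so that `f` enumerates exactly the subformulas of `x`. -/
def isMinFmlSeq (A x f r : Fin n) : Fm n :=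
  isFmlSeq A x f r ⩓ all fun g => all fun s => isFmlSeq A x g s ⟹ isLe r s

/-- `x` is a formula of `L_A`. -/
def isFml (A x : Fin n) : Fm n := ex fun f => ex fun r => isMinFmlSeq A x f r

/-- `D` is the set of all `i` such that `v_i` is one of the terms `t`, `s`. -/
def isVarSet (D t s : Fin n) : Fm n := all fun i => mem i D ⇔ (isVar t i ⩔ isVar s i)

/-- `F` is the set of the indices of the free variables of the formula `x` of `L_A`, computed by
recursion along an enumeration `f` of the subformulas of `x`. -/
def isFreeVars (A x F : Fin n) : Fm n :=
  ex fun f => ex fun r => ex fun d =>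
    isMinFmlSeq A x f r ⩓ isFunOn d r ⩓ lastVal d r F ⩓
    allIn r fun k => ex fun y => ex fun D => app f k y ⩓ app d k D ⩓
      ((ex fun t => ex fun s => isTerm A t ⩓ isTerm A s ⩓ (isEqCode y t s ⩔ isRCode y t s) ⩓
          isVarSet D t s) ⩔
       (ex fun t => isTerm A t ⩓ isUCode y t ⩓ isVarSet D t t) ⩔
       (exIn k fun j => ex fun u => app f j u ⩓ isNegCode y u ⩓ app d j D) ⩔
       (exIn k fun j => exIn k fun j' => ex fun u => ex fun u' => ex fun E => ex fun E' =>
          app f j u ⩓ app f j' u' ⩓ isAndCode y u u' ⩓ app d j E ⩓ app d j' E' ⩓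
          all fun i => mem i D ⇔ (mem i E ⩔ mem i E')) ⩔
       (exIn k fun j => ex fun i => ex fun u => ex fun E =>
          isNat i ⩓ app f j u ⩓ isExCode y i u ⩓ app d j E ⩓
          all fun i' => mem i' D ⇔ (mem i' E ⩓ ∼(eq i' i))))

/-- `x` is a formula `σ(v₀, …, v_{m-1})` of `L_A`, with free variables among `v₀, …, v_{m-1}`. -/
def isFmlIn (A x m : Fin n) : Fm n :=
  isFml A x ⩓ ex fun F => isFreeVars A x F ⩓ isSub F m

end Codes

/-! ### Structures, satisfaction, elementary embeddings -/

section Structures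

variable {n : ℕ}

/-- `𝓜 = ⟨M, U, R, I⟩` is an `L_A`-structure: `U ⊆ M`, `R ⊆ M × M` and `I : A → M`. -/
def isStrWith (A 𝓜 M U R I : Fin n) : Fm n :=
  isQuadruple 𝓜 M U R I ⩓ isSub U M ⩓
  (allIn R fun w => exIn M fun x => exIn M fun y => isPair w x y) ⩓ isFunTo I A M

/-- `𝓜` is an `L_A`-structure. -/
def isStr (A 𝓜 : Fin n) : Fm n :=
  ex fun M => ex fun U => ex fun R => ex fun I => isStrWith A 𝓜 M U R I

/-- `t` is a term of `L_A` that is a constant or one of the variables `v_i` with `i < l`. -/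
def isTermBelow (A l t : Fin n) : Fm n :=
  (exIn l fun i => isVar t i) ⩔ (exIn A fun a => isConst t a)

/-- `x` is the value of the term `t` under the constant assignment `I` and the assignment `h` of
length `l`. -/
def termVal (A I l h t x : Fin n) : Fm n :=
  (exIn l fun i => isVar t i ⩓ entry l h i x) ⩔ (exIn A fun a => isConst t a ⩓ app I a x)

/-- The assignments `h, h'` of length `l` agree except possibly at `i`. -/
def agreeOff (l h h' i : Fin n) : Fm n :=
  allIn l fun j => ∼(eq j i) ⟹ all fun x => entry l h j x ⇔ entry l h' j x

/-- The step of the definition of satisfaction: `g(k)` is the set of the assignments `h ∈ ˡM` that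
make the formula `f(k)` true, provided that this holds for earlier values. In particular, all
variables of `f(k)` have indices below `l`. -/
def satStep (A M U R I l f g k : Fin n) : Fm n :=
  ex fun y => ex fun G => app f k y ⩓ app g k G ⩓
    ((ex fun t => ex fun s => isTermBelow A l t ⩓ isTermBelow A l s ⩓ isEqCode y t s ⩓
        all fun h => mem h G ⇔ (isTuple l M h ⩓
          ex fun x => termVal A I l h t x ⩓ termVal A I l h s x)) ⩔
     (ex fun t => isTermBelow A l t ⩓ isUCode y t ⩓
        all fun h => mem h G ⇔ (isTuple l M h ⩓ exIn U fun x => termVal A I l h t x)) ⩔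
     (ex fun t => ex fun s => isTermBelow A l t ⩓ isTermBelow A l s ⩓ isRCode y t s ⩓
        all fun h => mem h G ⇔ (isTuple l M h ⩓
          ex fun x => ex fun x' => termVal A I l h t x ⩓ termVal A I l h s x' ⩓ app R x x')) ⩔
     (exIn k fun j => ex fun u => ex fun H => app f j u ⩓ isNegCode y u ⩓ app g j H ⩓
        all fun h => mem h G ⇔ (isTuple l M h ⩓ ∼(mem h H))) ⩔
     (exIn k fun j => exIn k fun j' => ex fun u => ex fun u' => ex fun H => ex fun H' =>
        app f j u ⩓ app f j' u' ⩓ isAndCode y u u' ⩓ app g j H ⩓ app g j' H' ⩓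
        all fun h => mem h G ⇔ (mem h H ⩓ mem h H')) ⩔
     (exIn k fun j => exIn l fun i => ex fun u => ex fun H =>
        app f j u ⩓ isExCode y i u ⩓ app g j H ⩓
        all fun h => mem h G ⇔ (isTuple l M h ⩓ exIn H fun h' => agreeOff l h h' i)))

/-- `𝓜 ⊨ σ(e(0), …, e(m-1))`, for a formula `σ(v₀, …, v_{m-1})` of `L_A` and `e ∈ ᵐM`: for some
`l ≥ m` that exceeds the indices of all variables (free or bound) of `σ`, some assignment in `ˡM`
that extends `e` belongs to the set of assignments that make `σ` true. -/
def isSat (A 𝓜 x m e : Fin n) : Fm n :=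
  ex fun M => ex fun U => ex fun R => ex fun I => ex fun f => ex fun r => ex fun g => ex fun l =>
    isStrWith A 𝓜 M U R I ⩓ isMinFmlSeq A x f r ⩓ isFunOn g r ⩓ isNat l ⩓ isLe m l ⩓
    (allIn r fun k => satStep A M U R I l f g k) ⩓
    ex fun G => lastVal g r G ⩓ exIn G fun h =>
      allIn m fun i => all fun z => entry m e i z ⇔ entry l h i z

/-- `f` is an `L_A`-elementary embedding of `𝓜` into `𝓝`. -/
def isElemEmb (A f 𝓜 𝓝 : Fin n) : Fm n :=
  ex fun M => ex fun U => ex fun R => ex fun I => ex fun N => ex fun Z => ex fun S => ex fun J =>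
    isStrWith A 𝓜 M U R I ⩓ isStrWith A 𝓝 N Z S J ⩓ isFunTo f M N ⩓ isInj f ⩓
    all fun x => all fun m => all fun e => all fun e' =>
      (isNat m ⩓ isFmlIn A x m ⩓ isTuple m M e ⩓ isTuple m N e' ⩓
        (allIn m fun i => all fun u => all fun w => (entry m e i u ⩓ app f u w) ⟹ entry m e' i w)) ⟹
      (isSat A 𝓜 x m e ⇔ isSat A 𝓝 x m e')

end Structures

/-! ### Axioms and theories -/

/-- Extensionality. -/
def axExt : LSet.Sentence :=
  (all fun x => all fun y => (all fun z => mem z x ⇔ mem z y) ⟹ eq x y : Fm 0)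

/-- Empty set. -/
def axEmpty : LSet.Sentence := (ex fun x => isEmpty x : Fm 0)

/-- Pairing. -/
def axPair : LSet.Sentence := (all fun x => all fun y => ex fun z => isUPair z x y : Fm 0)

/-- Union. -/
def axUnion : LSet.Sentence :=
  (all fun x => ex fun u => all fun w => mem w u ⇔ exIn x fun y => mem w y : Fm 0)

/-- Cartesian product. -/
def axCartProd : LSet.Sentence := (all fun X => all fun Y => ex fun P => isProd P X Y : Fm 0)

/-- Separation for `φ(p, x)`: for all parameters `p` and every `a`, `{x ∈ a : φ(p, x)}` is a set. -/
def axSep {k : ℕ} (φ : LSet.Formula (Fin k ⊕ Fin 1)) : LSet.Sentence :=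
  (all fun a => ex fun b => all fun x =>
    mem x b ⇔ (mem x a ⩓ inst φ (fun i => i) ![x]) : Fm k).alls

/-- Induction along `ω` for `φ(p, x)`: for all parameters `p`, if `φ(p, x)` implies `x ∈ ω`, holds at
`∅`, and passes from `x ∈ ω` to `x ∪ {x}`, then it holds at every `x ∈ ω`. -/
def axInd {k : ℕ} (φ : LSet.Formula (Fin k ⊕ Fin 1)) : LSet.Sentence :=
  ((all fun x => inst φ (fun i => i) ![x] ⟹ isNat x) ⟹
    ((all fun z => isEmpty z ⟹ inst φ (fun i => i) ![z]) ⩓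
      (all fun x => (isNat x ⩓ inst φ (fun i => i) ![x]) ⟹
        all fun y => isSuccOf y x ⟹ inst φ (fun i => i) ![y])) ⟹
    (all fun x => isNat x ⟹ inst φ (fun i => i) ![x]) : Fm k).alls

/-- Replacement for `φ(p, x, y)`: for all parameters `p` with `∀ x ∃! y φ(p, x, y)` and every `a`,
`{y : ∃ x ∈ a, φ(p, x, y)}` is a set. -/
def axRep {k : ℕ} (φ : LSet.Formula (Fin k ⊕ Fin 2)) : LSet.Sentence :=
  ((all fun x => ex fun y => inst φ (fun i => i) ![(x : Fin (k + 2)), y] ⩓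
      all fun z => inst φ (fun i => i) ![(x : Fin (k + 3)), z] ⟹ eq z y) ⟹
    (all fun a => ex fun b => all fun y =>
      mem y b ⇔ exIn a fun x => inst φ (fun i => i) ![x, (y : Fin (k + 4))]) : Fm k).alls

/-- Vopěnka's principle for `φ(p, x)`: for all parameters `p` and every set `A`, if the class
`X = {x : φ(p, x)}` is proper (not equal to any set) and consists of `L_A`-structures, then there are
distinct `𝓜, 𝓝 ∈ X` and an `L_A`-elementary embedding of `𝓜` into `𝓝`. -/
def axVP {k : ℕ} (φ : LSet.Formula (Fin k ⊕ Fin 1)) : LSet.Sentence :=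
  (all fun A =>
    ((all fun x => ex fun y => (inst φ (fun i => i) ![y] ⩓ ∼(mem y x)) ⩔
        (∼(inst φ (fun i => i) ![y]) ⩓ mem y x)) ⩓
      (all fun y => inst φ (fun i => i) ![y] ⟹ isStr A y)) ⟹
    (ex fun 𝓜 => ex fun 𝓝 => ex fun f =>
      inst φ (fun i => i) ![(𝓜 : Fin (k + 4))] ⩓ inst φ (fun i => i) ![(𝓝 : Fin (k + 4))] ⩓
      ∼(eq 𝓜 𝓝) ⩓ isElemEmb A f 𝓜 𝓝) : Fm k).alls

/-- The `Δ₀`-Separation scheme. -/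
def Delta0Sep : LSet.Theory :=
  {σ | ∃ (k : ℕ) (φ : LSet.Formula (Fin k ⊕ Fin 1)), IsDelta0 φ ∧ σ = axSep φ}

/-- The full Separation scheme. -/
def Sep : LSet.Theory := {σ | ∃ (k : ℕ) (φ : LSet.Formula (Fin k ⊕ Fin 1)), σ = axSep φ}

/-- The scheme of induction along `ω`. -/
def IndOmega : LSet.Theory := {σ | ∃ (k : ℕ) (φ : LSet.Formula (Fin k ⊕ Fin 1)), σ = axInd φ}

/-- The `Δ₀`-Replacement scheme. -/
def Delta0Rep : LSet.Theory :=
  {σ | ∃ (k : ℕ) (φ : LSet.Formula (Fin k ⊕ Fin 2)), IsDelta0 φ ∧ σ = axRep φ}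

/-- The full Replacement scheme. -/
def Rep : LSet.Theory := {σ | ∃ (k : ℕ) (φ : LSet.Formula (Fin k ⊕ Fin 2)), σ = axRep φ}

/-- Vopěnka's principle, as a scheme. -/
def VP : LSet.Theory := {σ | ∃ (k : ℕ) (φ : LSet.Formula (Fin k ⊕ Fin 1)), σ = axVP φ}

/-- The theory `EST₀`. -/
def EST₀ : LSet.Theory := {axExt, axEmpty, axPair, axUnion, axCartProd} ∪ Delta0Sep

/-- Elementary set theory `EST`. -/
def EST : LSet.Theory := EST₀ ∪ IndOmega

/-- `T` proves every sentence of `S`, i.e. every sentence of `S` is a first-order consequence of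
`T` (true in all models of `T`). -/
def Proves (T S : LSet.Theory) : Prop := ∀ σ ∈ S, T ⊨ᵇ σ

end WeakSet

/-! Work in an arbitrary model. Let `φ(p, x, y)` define a total function and let `a` be a set. For
`x ∈ a` with value `y`, form the structure `str a I x y`, that is `⟨a ∪ {y}, {x}, {⟨y, y⟩}, I⟩` with
`I` the identity on `a`, in the language `L_a`. Every element of `a` is named by itself, so the
sentence `U(c_x)` holds in this structure, while in the structure attached to `x'` it says `x = x'`.

If the class of these structures were proper, Vopěnka's principle would give two distinct members
and an elementary embedding between them. Preservation of `U(c_x)` forces `x = x'`, functionality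
forces `y = y'`, and the structures coincide, a contradiction. So the class is a set, and its `y`s
are collected by `Δ₀`-Separation from an iterated union (`exists_image_of_str`). The result is
`replacement`.

The complexity of `φ` plays no role, since Vopěnka's principle is available for every formula. Full
Replacement therefore comes in one stroke, and the two claims about `Δ₀`-Replacement are weakenings
of it. Separation follows by replacing along a map that fixes the good elements and sends the others
to a fixed good one.

Most of the work is to evaluate the formalized satisfaction relation at `U(c_b)`:
`realize_isFmlIn_uCode` and `realize_isSat_uCode`, combined in `mem_of_isElemEmb` and `vopenka`. No
general theory of satisfaction is needed, because this sentence is atomic and has no variables. -/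

namespace WeakSet

open FirstOrder FirstOrder.Language

/-! ### Elementary set theory inside a model -/

section Semantics

variable {N : Type*} [LSet.Structure N]

/-- The membership relation of a structure for the language of set theory. -/
def E (x y : N) : Prop := Structure.RelMap (L := LSet) (MemSymb.mem : LSet.Relations 2) ![x, y]

local infix:50 " ε " => E

variable {n : ℕ} {v : Empty → N} {xs : Fin n → N}

@[simp] lemma realize_mem (x y : Fin n) : (mem x y).Realize v xs ↔ xs x ε xs y := by
  exact BoundedFormula.realize_rel₂ (L := LSet) (R := MemSymb.mem)

@[simp] lemma realize_eq (x y : Fin n) : (eq x y).Realize v xs ↔ xs x = xs y := by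
  simp [eq]

@[simp] lemma realize_all' (φ : Fin (n + 1) → Fm (n + 1)) :
    (all φ).Realize v xs ↔ ∀ a, (φ (Fin.last n)).Realize v (Fin.snoc xs a) := by
  simp [all]

@[simp] lemma realize_ex' (φ : Fin (n + 1) → Fm (n + 1)) :
    (ex φ).Realize v xs ↔ ∃ a, (φ (Fin.last n)).Realize v (Fin.snoc xs a) := by
  simp [ex]

@[simp] lemma realize_allIn (a : Fin n) (φ : Fin (n + 1) → Fm (n + 1)) :
    (allIn a φ).Realize v xs ↔ ∀ x, x ε xs a → (φ (Fin.last n)).Realize v (Fin.snoc xs x) := by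
  simp [allIn]

@[simp] lemma realize_exIn (a : Fin n) (φ : Fin (n + 1) → Fm (n + 1)) :
    (exIn a φ).Realize v xs ↔ ∃ x, x ε xs a ∧ (φ (Fin.last n)).Realize v (Fin.snoc xs x) := by
  simp [exIn]

@[simp] lemma realize_inst {k m : ℕ} (φ : LSet.Formula (Fin k ⊕ Fin m)) (p : Fin k → Fin n)
    (a : Fin m → Fin n) :
    (inst φ p a).Realize v xs ↔ φ.Realize (Sum.elim (xs ∘ p) (xs ∘ a)) := by
  unfold inst
  refine (BoundedFormula.realize_relabel (n := 0)).trans ?_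
  unfold Formula.Realize
  refine iff_of_eq (congrArg₂ _ ?_ (Subsingleton.elim _ _))
  funext i
  rcases i with i | i <;> rfl

@[simp] lemma realize_isSub (x y : Fin n) :
    (isSub x y).Realize v xs ↔ ∀ w, w ε xs x → w ε xs y := by
  simp [isSub]

/-- Semantic form of the axioms of `EST` that do not involve formulas. -/
class IsEST (N : Type*) [LSet.Structure N] : Prop where
  ext : ∀ x y : N, (∀ z, E z x ↔ E z y) → x = y
  empty : ∃ x : N, ∀ z, ¬ E z x
  pair : ∀ x y : N, ∃ z, ∀ w, E w z ↔ w = x ∨ w = y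
  union : ∀ x : N, ∃ u, ∀ w, E w u ↔ ∃ y, E y x ∧ E w y
  prod : ∀ X Y : N, ∃ P, ∀ w, E w P ↔ ∃ x, E x X ∧ ∃ y, E y Y ∧
    ∃ s t, (∀ u, E u s ↔ u = x ∨ u = x) ∧ (∀ u, E u t ↔ u = x ∨ u = y) ∧
      ∀ u, E u w ↔ u = s ∨ u = t

variable [IsEST N]

variable (N) in
/-- The empty set of the model. -/
noncomputable def emp : N := (IsEST.empty (N := N)).choose

@[simp] lemma not_mem_emp (x : N) : ¬ x ε emp N := (IsEST.empty (N := N)).choose_spec x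

/-- The unordered pair in the model. -/
noncomputable def upair (x y : N) : N := (IsEST.pair x y).choose

@[simp] lemma mem_upair (x y w : N) : w ε upair x y ↔ w = x ∨ w = y :=
  (IsEST.pair x y).choose_spec w

/-- The union of a set in the model. -/
noncomputable def sUn (x : N) : N := (IsEST.union x).choose

@[simp] lemma mem_sUn (x w : N) : w ε sUn x ↔ ∃ y, y ε x ∧ w ε y :=
  (IsEST.union x).choose_spec w

lemma eq_emp_iff (x : N) : x = emp N ↔ ∀ w, ¬ w ε x :=
  ⟨by rintro rfl; simp, fun h => IsEST.ext _ _ fun z => by simp [h z]⟩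

lemma eq_upair_iff (z x y : N) : z = upair x y ↔ ∀ w, w ε z ↔ w = x ∨ w = y :=
  ⟨by rintro rfl; simp, fun h => IsEST.ext _ _ fun z => by simp [h z]⟩

/-- The ordered pair in the model. -/
noncomputable def opair (x y : N) : N := upair (upair x x) (upair x y)

lemma upair_self_inj {x y : N} : upair x x = upair y y ↔ x = y :=
  ⟨fun h => by have := (mem_upair y y x).1 (h ▸ by simp); simpa using this, fun h => h ▸ rfl⟩

@[simp] lemma opair_inj {x y x' y' : N} : opair x y = opair x' y' ↔ x = x' ∧ y = y' := by
  refine ⟨fun h => ?_, by rintro ⟨rfl, rfl⟩; rfl⟩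
  have H : ∀ w, (w = upair x x ∨ w = upair x y) ↔ (w = upair x' x' ∨ w = upair x' y') := fun w => by
    rw [← mem_upair, ← mem_upair]; exact iff_of_eq (congrArg (E w) h)
  have hx : x = x' := by
    rcases (H (upair x x)).1 (Or.inl rfl) with h | h
    · exact upair_self_inj.1 h
    · have : x' ε upair x x := h ▸ by simp
      simpa using (by simpa using this : x' = x).symm
  subst hx
  refine ⟨rfl, ?_⟩
  -- Used in both directions: if `y = x`, the information must come from `y'` instead.
  have key : ∀ a b : N, (upair x a = upair x x ∨ upair x a = upair x b) → a = x ∨ a = b := by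
    rintro a b (h | h)
    · have : a ε upair x x := h ▸ by simp
      left; simpa using this
    · have : a ε upair x b := h ▸ by simp
      simpa using this
  rcases key y y' ((H _).1 (Or.inr rfl)) with h1 | h1
  · rcases key y' y ((H _).2 (Or.inr rfl)) with h2 | h2
    · rw [h1, h2]
    · exact h2.symm
  · exact h1

/-- The successor `x ∪ {x}` in the model. -/
noncomputable def suc (x : N) : N := sUn (upair x (upair x x))

@[simp] lemma mem_suc (x w : N) : w ε suc x ↔ w ε x ∨ w = x := by
  simp [suc]

lemma eq_suc_iff (y x : N) : y = suc x ↔ ∀ w, w ε y ↔ w ε x ∨ w = x :=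
  ⟨by rintro rfl; simp, fun h => IsEST.ext _ _ fun z => by simp [h z]⟩

variable (N) in
/-- The numerals of the model. -/
noncomputable def num : ℕ → N
  | 0 => emp N
  | j + 1 => suc (num j)

@[simp] lemma realize_isEmpty (x : Fin n) : (isEmpty x).Realize v xs ↔ xs x = emp N := by
  simp [isEmpty, eq_emp_iff]

@[simp] lemma realize_isUPair (z x y : Fin n) :
    (isUPair z x y).Realize v xs ↔ xs z = upair (xs x) (xs y) := by
  simp [isUPair, eq_upair_iff]

@[simp] lemma realize_isPair (z x y : Fin n) :
    (isPair z x y).Realize v xs ↔ xs z = opair (xs x) (xs y) := by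
  simp [isPair, opair]

@[simp] lemma realize_isTriple (z x y w : Fin n) :
    (isTriple z x y w).Realize v xs ↔ xs z = opair (opair (xs x) (xs y)) (xs w) := by
  simp [isTriple]

@[simp] lemma realize_isQuadruple (z x y w t : Fin n) :
    (isQuadruple z x y w t).Realize v xs ↔
      xs z = opair (opair (opair (xs x) (xs y)) (xs w)) (xs t) := by
  simp [isQuadruple]

@[simp] lemma realize_app (f x y : Fin n) :
    (app f x y).Realize v xs ↔ opair (xs x) (xs y) ε xs f := by
  simp [app]

@[simp] lemma realize_isSuccOf (y x : Fin n) :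
    (isSuccOf y x).Realize v xs ↔ xs y = suc (xs x) := by
  simp [isSuccOf, eq_suc_iff]

@[simp] lemma realize_isNum (j : ℕ) {n : ℕ} {xs : Fin n → N} (x : Fin n) :
    (isNum j x).Realize v xs ↔ xs x = num N j := by
  induction j generalizing n with
  | zero => simp [isNum, num]
  | succ j ih => simp [isNum, num, ih]

/-- Natural numbers of the model. -/
def NatP (x : N) : Prop :=
  (∀ y, y ε x → ∀ z, z ε y → z ε x) ∧
  (∀ y, y ε x → ∀ z, z ε x → y ε z ∨ y = z ∨ z ε y) ∧
  ∀ y, (y ε x ∨ y = x) → (y = emp N ∨ ∃ z, z ε y ∧ y = suc z)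

@[simp] lemma realize_isNat (x : Fin n) : (isNat x).Realize v xs ↔ NatP (xs x) := by
  simp [isNat, isOrd, isTrans, isSucc, NatP, and_assoc]

lemma natP_emp : NatP (emp N) := by simp [NatP]

lemma natP_suc {x : N} (h : NatP x) : NatP (suc x) := by
  obtain ⟨h1, h2, h3⟩ := h
  refine ⟨?_, ?_, ?_⟩
  · intro y hy z hz
    rw [mem_suc] at hy ⊢
    rcases hy with hy | rfl
    · exact Or.inl (h1 y hy z hz)
    · exact Or.inl hz
  · intro y hy z hz
    rw [mem_suc] at hy hz
    rcases hy with hy | rfl <;> rcases hz with hz | rfl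
    · exact h2 y hy z hz
    · exact Or.inl hy
    · exact Or.inr (Or.inr hz)
    · exact Or.inr (Or.inl rfl)
  · rintro y (hy | rfl)
    · exact h3 y ((mem_suc _ _).1 hy)
    · exact Or.inr ⟨x, by simp, rfl⟩

/-! ### Induction along `ω` and `Δ₀`-Separation in a model -/

/-- Realizing a formula with last variable `x` as a formula with one non-parameter variable. -/
def toParam {k : ℕ} (ψ : Fm (k + 1)) : LSet.Formula (Fin k ⊕ Fin 1) :=
  BoundedFormula.relabel (n := 0)
    (fun i : Empty ⊕ Fin (k + 1) =>
      Sum.inl (Sum.elim Empty.elim (Fin.snoc Sum.inl (Sum.inr 0) : Fin (k + 1) → Fin k ⊕ Fin 1) i))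
    ψ.toFormula

omit [IsEST N] in
@[simp] lemma realize_toParam {k : ℕ} (ψ : Fm (k + 1)) (p : Fin k → N) (x : Fin 1 → N) :
    (toParam ψ).Realize (Sum.elim p x) ↔ ψ.Realize default (Fin.snoc p (x 0)) := by
  unfold toParam
  refine (BoundedFormula.realize_relabel (n := 0)).trans ?_
  refine (iff_of_eq (congrArg₂ _ rfl (Subsingleton.elim _ default))).trans
    ((BoundedFormula.realize_toFormula ψ _).trans (iff_of_eq (congrArg₂ _ (Subsingleton.elim _ _) ?_)))
  funext i
  refine Fin.lastCases ?_ (fun i => ?_) i <;> simp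

lemma nat_induction (hI : N ⊨ IndOmega) {k : ℕ} (ψ : Fm (k + 1)) (p : Fin k → N)
    (h0 : ψ.Realize default (Fin.snoc p (emp N)))
    (hs : ∀ x, NatP x → ψ.Realize default (Fin.snoc p x) → ψ.Realize default (Fin.snoc p (suc x)))
    (x : N) (hx : NatP x) : ψ.Realize default (Fin.snoc p x) := by
  -- The scheme covers only formulas that imply `x ∈ ω`, hence the added conjunct.
  have := hI.realize_of_mem (axInd (toParam (isNat (Fin.last k) ⊓ ψ))) ⟨k, _, rfl⟩
  unfold axInd at this
  rw [Sentence.Realize, BoundedFormula.realize_alls] at this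
  have := this p
  simp only [realize_all', BoundedFormula.realize_imp, WeakSet.and, BoundedFormula.realize_inf,
    realize_inst, Function.comp_def, realize_toParam, Fin.snoc_castSucc, realize_isNat,
    realize_isEmpty, realize_isSuccOf, Fin.snoc_last, Matrix.cons_val_zero] at this
  refine (this (fun _ h => h.1) ⟨?_, ?_⟩ x hx).2
  · rintro _ rfl
    exact ⟨natP_emp, h0⟩
  · rintro x ⟨hx, -, hψ⟩ _ rfl
    exact ⟨natP_suc hx, hs x hx hψ⟩

/-- `∅` is the least natural number and `1` is the next one. -/
lemma NatP.eq_emp_or_one_le (hI : N ⊨ IndOmega) {x : N} (hx : NatP x) :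
    x = emp N ∨ suc (emp N) ε x ∨ suc (emp N) = x := by
  -- Induction is available only for definable properties, so the claim is first written as a
  -- formula.
  have key : ∀ x : N, BoundedFormula.Realize (or (isEmpty (Fin.last 0)) (ex fun z => ex fun w =>
      and (isEmpty w) (and (isSuccOf z.castSucc w)
        (or (mem z.castSucc (Fin.last 0).castSucc.castSucc)
          (eq z.castSucc (Fin.last 0).castSucc.castSucc)))))
      default (Fin.snoc (default : Fin 0 → N) x) ↔
        x = emp N ∨ suc (emp N) ε x ∨ suc (emp N) = x := fun x => by
    simp only [WeakSet.and, WeakSet.or, BoundedFormula.realize_sup, BoundedFormula.realize_inf,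
      realize_ex', realize_isEmpty, realize_isSuccOf, realize_mem, realize_eq, Fin.snoc_castSucc,
      Fin.snoc_last]
    simp
  refine (key x).1 (nat_induction hI _ _ ((key _).2 (Or.inl rfl)) (fun x _ h => (key _).2 ?_) x hx)
  rcases (key x).1 h with rfl | h | rfl
  · exact Or.inr (Or.inr rfl)
  · exact Or.inr (Or.inl (by simp [h]))
  · exact Or.inr (Or.inl (by simp))

omit [IsEST N] in
lemma separation (h : N ⊨ Delta0Sep) {k : ℕ} (φ : LSet.Formula (Fin k ⊕ Fin 1)) (hφ : IsDelta0 φ)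
    (p : Fin k → N) (a : N) :
    ∃ b, ∀ x, x ε b ↔ x ε a ∧ φ.Realize (Sum.elim p fun _ => x) := by
  have := h.realize_of_mem (axSep φ) ⟨k, _, hφ, rfl⟩
  unfold axSep at this
  rw [Sentence.Realize, BoundedFormula.realize_alls] at this
  have := this p
  simp [Function.comp_def] at this
  exact this a

/-! ### Semantics of the syntax of `L_A` -/

/-- `f` is a function on `X`. -/
def FunOn (f X : N) : Prop :=
  (∀ p, p ε f → ∃ x, x ε X ∧ ∃ y, p = opair x y) ∧
  ∀ x, x ε X → ∃ y, opair x y ε f ∧ ∀ z, opair x z ε f → z = y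

@[simp] lemma realize_isFunOn (f X : Fin n) :
    (isFunOn f X).Realize v xs ↔ FunOn (xs f) (xs X) := by
  simp [isFunOn, FunOn]

/-- `p` lists the initial segments of the tuple `h` of length `l`. -/
def Prefixes (p l h : N) : Prop :=
  FunOn p (suc l) ∧ opair (emp N) (emp N) ε p ∧ opair l h ε p ∧
  ∀ k, k ε l → ∃ r, opair k r ε p ∧ ∃ x, opair (suc k) (opair r (opair k x)) ε p

@[simp] lemma realize_isPrefixes (p l h : Fin n) :
    (isPrefixes p l h).Realize v xs ↔ Prefixes (xs p) (xs l) (xs h) := by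
  simp [isPrefixes, isAppend, Prefixes]

/-- The tuple `h` of length `l` has the entry `x` at `i`. -/
def Entry (l h i x : N) : Prop :=
  i ε l ∧ ∃ p r, Prefixes p l h ∧ opair i r ε p ∧ opair (suc i) (opair r (opair i x)) ε p

@[simp] lemma realize_entry (l h i x : Fin n) :
    (entry l h i x).Realize v xs ↔ Entry (xs l) (xs h) (xs i) (xs x) := by
  simp [entry, isAppend, Entry]

/-- `h` is a tuple of length `l` of elements of `M`. -/
def Tuple (l M h : N) : Prop := (∃ p, Prefixes p l h) ∧ ∀ i x, Entry l h i x → x ε M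

@[simp] lemma realize_isTuple (l M h : Fin n) :
    (isTuple l M h).Realize v xs ↔ Tuple (xs l) (xs M) (xs h) := by
  simp [isTuple, Tuple]

/-- The singleton in the model. -/
noncomputable def sing (x : N) : N := upair x x

@[simp] lemma mem_sing (x w : N) : w ε sing x ↔ w = x := by simp [sing]

lemma funOn_sing (x y : N) : FunOn (sing (opair x y)) (sing x) := by
  simp [FunOn]

/-- Since `1 = {∅}`, this describes all sequences of length one: construction sequences of an atomic
formula, and lists of prefixes of the empty tuple. -/
lemma funOn_sing_iff (f x : N) : FunOn f (sing x) ↔ ∃ y, f = sing (opair x y) := by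
  refine ⟨?_, by rintro ⟨y, rfl⟩; exact funOn_sing x y⟩
  simp only [FunOn, mem_sing, exists_eq_left, forall_eq]
  rintro ⟨h1, y, hy, h2⟩
  refine ⟨y, IsEST.ext _ _ fun z => ?_⟩
  rw [mem_sing]
  refine ⟨fun hz => ?_, by rintro rfl; exact hy⟩
  obtain ⟨w, rfl⟩ := h1 z hz
  rw [h2 w hz]

lemma suc_emp : suc (emp N) = sing (emp N) := IsEST.ext _ _ fun z => by simp

lemma prefixes_emp_iff (p h : N) :
    Prefixes p (emp N) h ↔ p = sing (opair (emp N) (emp N)) ∧ h = emp N := by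
  simp only [Prefixes, suc_emp, funOn_sing_iff]
  constructor
  · rintro ⟨⟨y, rfl⟩, h1, h2, -⟩
    simp at h1 h2
    simp [h1, h2]
  · rintro ⟨rfl, rfl⟩
    simpa using ⟨_, rfl⟩

@[simp] lemma not_entry_emp (h i x : N) : ¬ Entry (emp N) h i x := by simp [Entry]

@[simp] lemma tuple_emp_iff (M h : N) : Tuple (emp N) M h ↔ h = emp N := by
  simp [Tuple, prefixes_emp_iff]

@[simp] lemma realize_isVar (t i : Fin n) :
    (isVar t i).Realize v xs ↔ xs t = opair (num N 0) (xs i) := by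
  simp [isVar]

@[simp] lemma realize_isConst (t i : Fin n) :
    (isConst t i).Realize v xs ↔ xs t = opair (num N 1) (xs i) := by
  simp [isConst]

/-- `t` is a term of `L_A`. -/
def IsTm (A t : N) : Prop :=
  (∃ i, NatP i ∧ t = opair (num N 0) i) ∨ ∃ a, a ε A ∧ t = opair (num N 1) a

@[simp] lemma realize_isTerm (A t : Fin n) : (isTerm A t).Realize v xs ↔ IsTm (xs A) (xs t) := by
  simp [isTerm, IsTm]

@[simp] lemma realize_isEqCode (x t s : Fin n) : (isEqCode x t s).Realize v xs ↔
    xs x = opair (opair (num N 2) (xs t)) (xs s) := by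
  simp [isEqCode]

@[simp] lemma realize_isNegCode (x y : Fin n) : (isNegCode x y).Realize v xs ↔
    xs x = opair (num N 3) (xs y) := by
  simp [isNegCode]

@[simp] lemma realize_isAndCode (x y z : Fin n) : (isAndCode x y z).Realize v xs ↔
    xs x = opair (opair (num N 4) (xs y)) (xs z) := by
  simp [isAndCode]

@[simp] lemma realize_isExCode (x i y : Fin n) : (isExCode x i y).Realize v xs ↔
    xs x = opair (opair (num N 5) (xs i)) (xs y) := by
  simp [isExCode]

@[simp] lemma realize_isUCode (x t : Fin n) : (isUCode x t).Realize v xs ↔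
    xs x = opair (num N 6) (xs t) := by
  simp [isUCode]

@[simp] lemma realize_isRCode (x t s : Fin n) : (isRCode x t s).Realize v xs ↔
    xs x = opair (opair (num N 7) (xs t)) (xs s) := by
  simp [isRCode]

/-- `x` is an atomic formula of `L_A`. -/
def AFml (A x : N) : Prop :=
  (∃ t s, IsTm A t ∧ IsTm A s ∧
    (x = opair (opair (num N 2) t) s ∨ x = opair (opair (num N 7) t) s)) ∨
  ∃ t, IsTm A t ∧ x = opair (num N 6) t

@[simp] lemma realize_isAFml (A x : Fin n) : (isAFml A x).Realize v xs ↔ AFml (xs A) (xs x) := by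
  simp [isAFml, AFml]

@[simp] lemma realize_lastVal (f r x : Fin n) : (lastVal f r x).Realize v xs ↔
    ∃ k, xs r = suc k ∧ opair k (xs x) ε xs f := by
  simp [lastVal]

/-- `f` is a construction sequence of length `r` for the formula `x` of `L_A`. -/
def FmlSeq (A x f r : N) : Prop :=
  NatP r ∧ r ≠ emp N ∧ FunOn f r ∧ (∃ k, r = suc k ∧ opair k x ε f) ∧
  ∀ k, k ε r → ∃ y, opair k y ε f ∧ (AFml A y ∨
    (∃ j, j ε k ∧ ∃ u, opair j u ε f ∧ y = opair (num N 3) u) ∨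
    (∃ j, j ε k ∧ ∃ j', j' ε k ∧ ∃ u, opair j u ε f ∧ ∃ u', opair j' u' ε f ∧
      y = opair (opair (num N 4) u) u') ∨
    (∃ j, j ε k ∧ ∃ i, NatP i ∧ ∃ u, opair j u ε f ∧ y = opair (opair (num N 5) i) u))

@[simp] lemma realize_isFmlSeq (A x f r : Fin n) :
    (isFmlSeq A x f r).Realize v xs ↔ FmlSeq (xs A) (xs x) (xs f) (xs r) := by
  simp [isFmlSeq, FmlSeq]

/-- `f` is a construction sequence of minimal length `r` for the formula `x` of `L_A`. -/
def MinFmlSeq (A x f r : N) : Prop :=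
  FmlSeq A x f r ∧ ∀ g s, FmlSeq A x g s → r ε s ∨ r = s

@[simp] lemma realize_isMinFmlSeq (A x f r : Fin n) :
    (isMinFmlSeq A x f r).Realize v xs ↔ MinFmlSeq (xs A) (xs x) (xs f) (xs r) := by
  simp [isMinFmlSeq, MinFmlSeq, isLe]

lemma suc_emp_ne : suc (emp N) ≠ emp N := fun h => by
  have : emp N ε suc (emp N) := by simp
  rw [h] at this
  simp at this

/-! ### The sentence `U(c_b)`: construction, free variables, truth -/

/-- The code of the sentence `U(c_b)`. -/
noncomputable def uCode (b : N) : N := opair (num N 6) (opair (num N 1) b)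

lemma fmlSeq_uCode {A b : N} (hb : b ε A) :
    FmlSeq A (uCode b) (sing (opair (emp N) (uCode b))) (suc (emp N)) := by
  refine ⟨natP_suc natP_emp, suc_emp_ne, ?_, ⟨emp N, rfl, by simp⟩, ?_⟩
  · rw [suc_emp]; exact funOn_sing _ _
  · intro k hk
    obtain rfl : k = emp N := by simpa using hk
    exact ⟨uCode b, by simp, Or.inl (Or.inr ⟨_, Or.inr ⟨b, hb, rfl⟩, rfl⟩)⟩

/-- An atomic formula has a construction sequence of length one, and no nonzero natural number lies
below one. The latter is the only place where induction along `ω` is needed. -/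
lemma minFmlSeq_uCode_iff (hI : N ⊨ IndOmega) {A b f r : N} (hb : b ε A) :
    MinFmlSeq A (uCode b) f r ↔ f = sing (opair (emp N) (uCode b)) ∧ r = suc (emp N) := by
  constructor
  · rintro ⟨h1, h2⟩
    have hr : r = suc (emp N) := by
      refine (h2 _ _ (fmlSeq_uCode hb)).resolve_left fun h => h1.2.1 (by simpa using h)
    subst hr
    refine ⟨?_, rfl⟩
    obtain ⟨-, -, hf, ⟨k, hk, hkf⟩, -⟩ := h1
    rw [suc_emp, funOn_sing_iff] at hf
    obtain ⟨y, rfl⟩ := hf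
    simp only [mem_sing, opair_inj] at hkf
    rw [hkf.2]
  · rintro ⟨rfl, rfl⟩
    refine ⟨fmlSeq_uCode hb, fun g s hs => ?_⟩
    exact (hs.1.eq_emp_or_one_le hI).resolve_left hs.2.1

/-- A Kuratowski pair has at most two elements, whereas `6` contains the distinct elements `0, 1,
2`. This separates the code `⟨6, t⟩` from the codes `⟨⟨q, t⟩, s⟩`. -/
lemma num_six_ne_opair (x y : N) : num N 6 ≠ opair x y := by
  intro h
  have h0 : num N 0 ε opair x y := h ▸ by simp [num]
  have h1 : num N 1 ε opair x y := h ▸ by simp [num]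
  have h2 : num N 2 ε opair x y := h ▸ by simp [num]
  have h01 : num N 1 ≠ num N 0 := suc_emp_ne
  have h02 : num N 2 ≠ num N 0 := fun h => by
    have : num N 1 ε num N 2 := by simp [num]
    rw [h] at this
    simp [num] at this
  have h12 : num N 2 ≠ num N 1 := fun h => by
    have : num N 1 ε num N 2 := by simp [num]
    rw [h] at this
    simp [num, suc_emp_ne] at this
  simp only [opair, mem_upair] at h0 h1 h2
  grind

lemma realize_isFmlIn_uCode (hI : N ⊨ IndOmega) {b : N} (A x m : Fin n) (hb : b ε xs A)
    (hx : xs x = uCode b) : (isFmlIn A x m).Realize v xs := by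
  have h01 : num N 1 ≠ num N 0 := suc_emp_ne
  simp only [isFmlIn, isFml, isFreeVars, WeakSet.and, WeakSet.or, BoundedFormula.realize_inf,
    BoundedFormula.realize_sup, realize_ex', realize_isMinFmlSeq, Fin.snoc_castSucc, Fin.snoc_last,
    hx, minFmlSeq_uCode_iff hI hb, realize_isSub, realize_isFunOn, realize_lastVal, realize_allIn]
  -- The recursion for free variables has a single stage, with value `∅`.
  refine ⟨⟨_, _, rfl, rfl⟩, emp N, ⟨_, _, sing (opair (emp N) (emp N)), ⟨rfl, rfl⟩, ?_,
    ⟨emp N, rfl, by simp⟩, fun k hk => ?_⟩, by simp⟩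
  · rw [suc_emp]; exact funOn_sing _ _
  · obtain rfl : k = emp N := by simpa using hk
    refine ⟨uCode b, emp N, by simp, by simp, Or.inr (Or.inl ⟨opair (num N 1) b, ?_, ?_, ?_⟩)⟩
    · simpa [IsTm] using Or.inr hb
    · simp [uCode]
    -- A constant `⟨1, b⟩` is never a variable `⟨0, i⟩`, so `∅` is the right set of indices.
    · simp [isVarSet, h01]

/-- `⟨M, U, R, I⟩` is an `L_A`-structure. -/
def StrWith (A M U R I : N) : Prop :=
  (∀ w, w ε U → w ε M) ∧ (∀ w, w ε R → ∃ x, x ε M ∧ ∃ y, y ε M ∧ w = opair x y) ∧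
  FunOn I A ∧ ∀ x y, opair x y ε I → y ε M

@[simp] lemma realize_isStrWith (A 𝓜 M U R I : Fin n) :
    (isStrWith A 𝓜 M U R I).Realize v xs ↔
      xs 𝓜 = opair (opair (opair (xs M) (xs U)) (xs R)) (xs I) ∧
      StrWith (xs A) (xs M) (xs U) (xs R) (xs I) := by
  simp [isStrWith, StrWith, isFunTo]

/-- The value of a term is `x`. -/
def TermVal (A I l h t x : N) : Prop :=
  (∃ i, i ε l ∧ t = opair (num N 0) i ∧ Entry l h i x) ∨
  ∃ a, a ε A ∧ t = opair (num N 1) a ∧ opair a x ε I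

@[simp] lemma realize_termVal (A I l h t x : Fin n) : (termVal A I l h t x).Realize v xs ↔
    TermVal (xs A) (xs I) (xs l) (xs h) (xs t) (xs x) := by
  simp [termVal, TermVal]

lemma termVal_const_iff {A I l h b x : N} (hb : b ε A) :
    TermVal A I l h (opair (num N 1) b) x ↔ opair b x ε I := by
  have h01 : num N 1 ≠ num N 0 := suc_emp_ne
  simp [TermVal, h01]
  grind

lemma realize_isSat_uCode (hI : N ⊨ IndOmega) {b M U R I : N} (A 𝓜 x m e : Fin n) (hb : b ε xs A)
    (hx : xs x = uCode b) (hm : xs m = emp N)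
    (h𝓜 : xs 𝓜 = opair (opair (opair M U) R) I) (hs : StrWith (xs A) M U R I) :
    (isSat A 𝓜 x m e).Realize v xs ↔ ∃ z, z ε U ∧ opair b z ε I := by
  simp only [isSat, WeakSet.and, BoundedFormula.realize_inf,
    realize_ex', realize_isMinFmlSeq, Fin.snoc_castSucc, Fin.snoc_last,
    hx, minFmlSeq_uCode_iff hI hb, realize_isFunOn, realize_lastVal, realize_allIn,
    realize_exIn, realize_isStrWith, realize_isNat, h𝓜, opair_inj]
  constructor
  · rintro ⟨_, _, _, _, f, r, g, l, ⟨⟨⟨⟨rfl, rfl⟩, rfl⟩, rfl⟩, -⟩, ⟨rfl, rfl⟩, hg, -, -, hstep, G,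
      ⟨k, hk, hkG⟩, h, hh, -⟩
    rw [suc_emp, funOn_sing_iff] at hg
    obtain ⟨G', rfl⟩ := hg
    have := hstep (emp N) (by simp)
    simp only [mem_sing, opair_inj] at hkG
    obtain ⟨rfl, rfl⟩ := hkG
    have h6 := num_six_ne_opair (N := N)
    -- Only the clause for `U` survives: the equality and `R` clauses would make `6` a pair, and the
    -- other three ask for an index below `∅`.
    simp [satStep, isTermBelow, uCode, h6] at this
    have := (this.2 h).1 hh
    obtain ⟨-, z, hz, hv⟩ := this
    exact ⟨z, hz, (termVal_const_iff hb).1 hv⟩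
  · rintro ⟨z, hz, hbz⟩
    -- Take assignments of length `0`. The empty tuple is the only one, so the set of satisfying
    -- assignments is `{∅}`.
    refine ⟨_, _, _, _, _, _, sing (opair (emp N) (sing (emp N))), emp N,
      ⟨⟨⟨⟨rfl, rfl⟩, rfl⟩, rfl⟩, hs⟩, ⟨rfl, rfl⟩, ?_, natP_emp, by simp [isLe, hm], ?_,
      sing (emp N), ⟨emp N, rfl, by simp⟩, emp N, by simp, by simp [hm]⟩
    · rw [suc_emp]; exact funOn_sing _ _
    · intro k hk
      obtain rfl : k = emp N := by simpa using hk
      simp [satStep, isTermBelow, uCode, hb, termVal_const_iff hb]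
      grind

/-- Elementary embeddings preserve the truth of `U(c_b)`. -/
lemma mem_of_isElemEmb (hI : N ⊨ IndOmega) {b M U R I M' U' R' I' : N} (A f 𝓜 𝓝 : Fin n)
    (hb : b ε xs A) (h : (isElemEmb A f 𝓜 𝓝).Realize v xs)
    (h𝓜 : xs 𝓜 = opair (opair (opair M U) R) I) (h𝓝 : xs 𝓝 = opair (opair (opair M' U') R') I')
    (hU : ∃ z, z ε U ∧ opair b z ε I) : ∃ z, z ε U' ∧ opair b z ε I' := by
  simp only [isElemEmb, WeakSet.and, BoundedFormula.realize_inf, realize_ex', realize_all',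
    BoundedFormula.realize_imp, realize_isStrWith, Fin.snoc_castSucc, Fin.snoc_last, h𝓜, h𝓝,
    opair_inj] at h
  obtain ⟨_, _, _, _, _, _, _, _, ⟨⟨⟨⟨rfl, rfl⟩, rfl⟩, rfl⟩, hs⟩,
    ⟨⟨⟨⟨rfl, rfl⟩, rfl⟩, rfl⟩, hs'⟩, -, -, h⟩ := h
  -- With `m = 0` both argument tuples are empty, and the requirement that the embedding carry one
  -- to the other is vacuous.
  have := h (uCode b) (emp N) (emp N) (emp N) ⟨by simpa using natP_emp,
    realize_isFmlIn_uCode hI _ _ _ (by simpa using hb) (by simp), by simp, by simp, by simp⟩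
  rw [BoundedFormula.realize_iff,
    realize_isSat_uCode hI _ _ _ _ _ (by simpa using hb) (by simp) (by simp)
      (by simpa using h𝓜) (by simpa using hs),
    realize_isSat_uCode hI _ _ _ _ _ (by simpa using hb) (by simp) (by simp)
      (by simpa using h𝓝) (by simpa using hs')] at this
  exact this.1 hU

/-! ### Vopěnka's principle in a model -/

omit [LSet.Structure N] [IsEST N] in
@[simp] lemma comp_vec₂ (a b : Fin n) : xs ∘ ![a, b] = ![xs a, xs b] := by
  funext i; fin_cases i <;> rfl

omit [LSet.Structure N] [IsEST N] in
@[simp] lemma snoc_comp_castSucc {k : ℕ} (a : N) (g : Fin k → Fin n) :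
    ((Fin.snoc xs a : Fin (n + 1) → N) ∘ fun i => (g i).castSucc) = xs ∘ g := by
  funext i; simp

omit [LSet.Structure N] [IsEST N] in
@[simp] lemma snoc_comp_castSucc_self (a : N) :
    (Fin.snoc xs a : Fin (n + 1) → N) ∘ Fin.castSucc = xs := by
  funext i; simp

omit [LSet.Structure N] [IsEST N] in
@[simp] lemma comp_vec₁ (a : Fin n) : xs ∘ ![a] = fun _ => xs a := by
  funext i; fin_cases i; rfl

/-- Vopěnka's principle, with elementarity restricted to the sentences `U(c_b)`. -/
lemma vopenka (hI : N ⊨ IndOmega) (hVP : N ⊨ VP) {k : ℕ} (ψ : Fm (k + 1)) (p : Fin k → N) (A : N)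
    (hX : ¬ ∃ X, ∀ y, y ε X ↔ ψ.Realize default (Fin.snoc p y))
    (hstr : ∀ y, ψ.Realize default (Fin.snoc p y) →
      ∃ M U R I, y = opair (opair (opair M U) R) I ∧ StrWith A M U R I) :
    ∃ 𝓜 𝓝, ψ.Realize default (Fin.snoc p 𝓜) ∧ ψ.Realize default (Fin.snoc p 𝓝) ∧ 𝓜 ≠ 𝓝 ∧
      ∀ b M U R I M' U' R' I', b ε A → 𝓜 = opair (opair (opair M U) R) I →
        𝓝 = opair (opair (opair M' U') R') I' →
        (∃ z, z ε U ∧ opair b z ε I) → ∃ z, z ε U' ∧ opair b z ε I' := by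
  have := hVP.realize_of_mem (axVP (toParam ψ)) ⟨k, _, rfl⟩
  unfold axVP at this
  rw [Sentence.Realize, BoundedFormula.realize_alls] at this
  have := this p
  simp only [realize_all', BoundedFormula.realize_imp, WeakSet.and, WeakSet.or,
    BoundedFormula.realize_inf, BoundedFormula.realize_sup, BoundedFormula.realize_not,
    realize_inst, realize_toParam, Fin.snoc_castSucc, realize_ex', realize_mem, realize_eq,
    Fin.snoc_last, Function.comp_apply, Matrix.cons_val_zero, snoc_comp_castSucc, snoc_comp_castSucc_self,
    isStr, realize_isStrWith] at this
  obtain ⟨𝓜, 𝓝, f, h1, h2, h3, h4⟩ := this A ⟨fun X => by_contra fun hne => by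
    push Not at hne
    exact hX ⟨X, fun y => ⟨fun hy => by_contra fun h => (hne y).2 h hy, (hne y).1⟩⟩, hstr⟩
  refine ⟨𝓜, 𝓝, h1, h2, h3, fun b M U R I M' U' R' I' hb h𝓜 h𝓝 hU => ?_⟩
  exact mem_of_isElemEmb hI _ _ _ _ (by simpa using hb) h4 (by simpa using h𝓜)
    (by simpa using h𝓝) hU

/-! ### `Δ₀` formulas -/

section Delta0

variable {α : Type}

/-- `x ∈ y`. -/
def dmem (x y : α ⊕ Fin n) : LSet.BoundedFormula α n :=
  Relations.boundedFormula₂ (L := LSet) MemSymb.mem (Term.var x) (Term.var y)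

/-- `x = y`. -/
def deq (x y : α ⊕ Fin n) : LSet.BoundedFormula α n :=
  Term.bdEqual (Term.var x) (Term.var y)

/-- A variable below a further quantifier. -/
def up (x : α ⊕ Fin n) : α ⊕ Fin (n + 1) := Sum.map id Fin.castSucc x

/-- The variable bound by the innermost quantifier. -/
def new : α ⊕ Fin (n + 1) := Sum.inr (Fin.last n)

/-- `∀ z ∈ y, φ`. -/
def dall (y : α ⊕ Fin n) (φ : LSet.BoundedFormula α (n + 1)) : LSet.BoundedFormula α n :=
  BoundedFormula.all ((dmem new (up y)).imp φ)

/-- `∃ z ∈ y, φ`. -/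
def dex (y : α ⊕ Fin n) (φ : LSet.BoundedFormula α (n + 1)) : LSet.BoundedFormula α n :=
  BoundedFormula.ex (dmem new (up y) ⊓ φ)

lemma isDelta0_dmem (x y : α ⊕ Fin n) : IsDelta0 (dmem x y) := .rel _ _

lemma isDelta0_deq (x y : α ⊕ Fin n) : IsDelta0 (deq x y) := .equal _ _

lemma IsDelta0.dall {φ : LSet.BoundedFormula α (n + 1)} (h : IsDelta0 φ) (y : α ⊕ Fin n) :
    IsDelta0 (dall y φ) := .ball y h

lemma IsDelta0.dex {φ : LSet.BoundedFormula α (n + 1)} (h : IsDelta0 φ) (y : α ⊕ Fin n) :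
    IsDelta0 (dex y φ) := .bex y h

lemma IsDelta0.not {φ : LSet.BoundedFormula α n} (h : IsDelta0 φ) : IsDelta0 (∼φ) := .imp h .falsum

lemma IsDelta0.inf {φ ψ : LSet.BoundedFormula α n} (h : IsDelta0 φ) (h' : IsDelta0 ψ) :
    IsDelta0 (φ ⊓ ψ) := (IsDelta0.imp h h'.not).not

lemma IsDelta0.sup {φ ψ : LSet.BoundedFormula α n} (h : IsDelta0 φ) (h' : IsDelta0 ψ) :
    IsDelta0 (φ ⊔ ψ) := .imp h.not h'

/-- `z = {x, y}`, as a `Δ₀` formula. -/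
def dUPair (z x y : α ⊕ Fin n) : LSet.BoundedFormula α n :=
  dmem x z ⊓ dmem y z ⊓ dall z (deq new (up x) ⊔ deq new (up y))

/-- `z = ⟨x, y⟩`, as a `Δ₀` formula. -/
def dPair (z x y : α ⊕ Fin n) : LSet.BoundedFormula α n :=
  dex z (dex (up z) (dUPair (up new) (up (up x)) (up (up x)) ⊓
    dUPair new (up (up x)) (up (up y)) ⊓ dUPair (up (up z)) (up new) new))

lemma isDelta0_dUPair (z x y : α ⊕ Fin n) : IsDelta0 (dUPair z x y) :=
  ((isDelta0_dmem _ _).inf (isDelta0_dmem _ _)).inf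
    (((isDelta0_deq _ _).sup (isDelta0_deq _ _)).dall _)

lemma isDelta0_dPair (z x y : α ⊕ Fin n) : IsDelta0 (dPair z x y) :=
  ((((isDelta0_dUPair _ _ _).inf (isDelta0_dUPair _ _ _)).inf (isDelta0_dUPair _ _ _)).dex _).dex _

variable {w : α → N}

omit [LSet.Structure N] [IsEST N] in
@[simp] lemma elim_up (x : α ⊕ Fin n) (a : N) :
    Sum.elim w (Fin.snoc xs a : Fin (n + 1) → N) (up x) = Sum.elim w xs x := by
  rcases x with x | x <;> simp [up]

omit [LSet.Structure N] [IsEST N] in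
@[simp] lemma elim_new (a : N) : Sum.elim w (Fin.snoc xs a : Fin (n + 1) → N) new = a := by
  simp [new]

omit [IsEST N] in
@[simp] lemma realize_dmem (x y : α ⊕ Fin n) :
    (dmem x y).Realize w xs ↔ Sum.elim w xs x ε Sum.elim w xs y :=
  BoundedFormula.realize_rel₂ (L := LSet) (R := MemSymb.mem)

omit [IsEST N] in
@[simp] lemma realize_deq (x y : α ⊕ Fin n) :
    (deq x y).Realize w xs ↔ Sum.elim w xs x = Sum.elim w xs y := by
  simp [deq]

omit [IsEST N] in
@[simp] lemma realize_dall (y : α ⊕ Fin n) (φ : LSet.BoundedFormula α (n + 1)) :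
    (dall y φ).Realize w xs ↔ ∀ a, a ε Sum.elim w xs y → φ.Realize w (Fin.snoc xs a) := by
  simp [dall]

omit [IsEST N] in
@[simp] lemma realize_dex (y : α ⊕ Fin n) (φ : LSet.BoundedFormula α (n + 1)) :
    (dex y φ).Realize w xs ↔ ∃ a, a ε Sum.elim w xs y ∧ φ.Realize w (Fin.snoc xs a) := by
  simp [dex]

@[simp] lemma realize_dUPair (z x y : α ⊕ Fin n) : (dUPair z x y).Realize w xs ↔
    Sum.elim w xs z = upair (Sum.elim w xs x) (Sum.elim w xs y) := by
  simp only [dUPair, BoundedFormula.realize_inf, realize_dmem, realize_dall,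
    BoundedFormula.realize_sup, realize_deq, elim_new, elim_up, eq_upair_iff]
  grind

@[simp] lemma realize_dPair (z x y : α ⊕ Fin n) : (dPair z x y).Realize w xs ↔
    Sum.elim w xs z = opair (Sum.elim w xs x) (Sum.elim w xs y) := by
  simp only [dPair, BoundedFormula.realize_inf, realize_dUPair, realize_dex, elim_new, elim_up,
    opair]
  constructor
  · rintro ⟨s, -, t, -, ⟨rfl, rfl⟩, h⟩
    exact h
  · intro h
    -- The sets `{x}` and `{x, y}` are themselves elements of the pair, so quantifiers bounded by
    -- the pair find them.
    exact ⟨_, by simp [h], _, by simp [h], ⟨rfl, rfl⟩, h⟩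

end Delta0

/-! ### Replacement -/

/-- The identity function on a set exists. -/
lemma exists_idOn (hS : N ⊨ Delta0Sep) (a : N) :
    ∃ I : N, ∀ w, w ε I ↔ ∃ x, x ε a ∧ w = opair x x := by
  obtain ⟨P, hP⟩ := IsEST.prod a a
  -- The diagonal is cut out of `a × a` by a `Δ₀` condition: all elements of `w` are equal. For `w =
  -- {{x}, {x, y}}` this means `x = y`.
  obtain ⟨I, hI⟩ := separation hS (k := 0)
    (dall (Sum.inl (Sum.inr 0)) (dall (up (Sum.inl (Sum.inr 0))) (deq (up new) new)))
    (((isDelta0_deq _ _).dall _).dall _) default P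
  refine ⟨I, fun w => ?_⟩
  have hP' : w ε P ↔ ∃ x, x ε a ∧ ∃ y, y ε a ∧ w = opair x y := by
    rw [hP]
    simp only [← eq_upair_iff, opair, exists_and_left, exists_eq_left]
  rw [hI, hP', Formula.Realize]
  simp only [realize_dall, realize_deq, elim_new, elim_up, Sum.elim_inl, Sum.elim_inr]
  constructor
  · rintro ⟨⟨x, hx, y, hy, rfl⟩, h⟩
    have := h (upair x y) (by simp [opair]) (upair x x) (by simp [opair])
    have hyx : y ε upair x x := this ▸ by simp
    obtain rfl : y = x := by simpa using hyx
    exact ⟨y, hy, rfl⟩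
  · rintro ⟨x, hx, rfl⟩
    exact ⟨⟨x, hx, x, hx, rfl⟩, by simp [opair]⟩

/-- The set `a ∪ {y}`. -/
noncomputable def adj (a y : N) : N := sUn (upair a (sing y))

@[simp] lemma mem_adj (a y w : N) : w ε adj a y ↔ w ε a ∨ w = y := by simp [adj]

lemma eq_adj_iff (z a y : N) : z = adj a y ↔ ∀ w, w ε z ↔ w ε a ∨ w = y :=
  ⟨by rintro rfl; simp, fun h => IsEST.ext _ _ fun z => by simp [h z]⟩

/-- The structure `⟨a ∪ {y}, {x}, {⟨y, y⟩}, I⟩`. -/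
noncomputable def str (a I x y : N) : N :=
  opair (opair (opair (adj a y) (sing x)) (sing (opair y y))) I

/-- The class of the structures `str a I x y` with `x ∈ a` and `φ(p, x, y)`; the parameters are `p`,
`a` and `I`. -/
def strClass {k : ℕ} (φ : LSet.Formula (Fin k ⊕ Fin 2)) : Fm (k + 2 + 1) :=
  exIn (Fin.last k).castSucc.castSucc fun x => ex fun y =>
    inst φ (fun i => i.castSucc.castSucc.castSucc.castSucc.castSucc) ![x.castSucc, y] ⊓
    ex fun M => ex fun U => ex fun w => ex fun R =>
      (all fun t => mem t M.castSucc.castSucc.castSucc.castSucc ⇔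
        (mem t (Fin.last k).castSucc.castSucc.castSucc.castSucc.castSucc.castSucc.castSucc.castSucc.castSucc
          ⊔ eq t y.castSucc.castSucc.castSucc.castSucc.castSucc)) ⊓
      isUPair U.castSucc.castSucc x.castSucc.castSucc.castSucc.castSucc.castSucc
        x.castSucc.castSucc.castSucc.castSucc.castSucc ⊓
      isPair w.castSucc y.castSucc.castSucc.castSucc.castSucc y.castSucc.castSucc.castSucc.castSucc ⊓
      isUPair R w.castSucc w.castSucc ⊓
      isQuadruple (Fin.last (k + 2)).castSucc.castSucc.castSucc.castSucc.castSucc.castSucc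
        M.castSucc.castSucc.castSucc U.castSucc.castSucc R
        (Fin.last (k + 1)).castSucc.castSucc.castSucc.castSucc.castSucc.castSucc.castSucc

lemma realize_strClass {k : ℕ} (φ : LSet.Formula (Fin k ⊕ Fin 2)) (p : Fin k → N) (a I 𝓜 : N) :
    (strClass φ).Realize default
      (Fin.snoc (Fin.snoc (Fin.snoc p a : Fin (k + 1) → N) I : Fin (k + 2) → N) 𝓜) ↔
      ∃ x, x ε a ∧ ∃ y, φ.Realize (Sum.elim p ![x, y]) ∧ 𝓜 = str a I x y := by
  simp only [strClass, realize_exIn, realize_ex', BoundedFormula.realize_inf, realize_inst,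
    realize_all', BoundedFormula.realize_iff, BoundedFormula.realize_sup, realize_mem, realize_eq,
    realize_isUPair, realize_isPair, realize_isQuadruple, Fin.snoc_castSucc, Fin.snoc_last,
    comp_vec₂, snoc_comp_castSucc, snoc_comp_castSucc_self, ← eq_adj_iff]
  constructor
  · rintro ⟨x, hx, y, hφ, M, U, w, R, ⟨⟨⟨rfl, rfl⟩, rfl⟩, rfl⟩, rfl⟩
    exact ⟨x, hx, y, hφ, rfl⟩
  · rintro ⟨x, hx, y, hφ, rfl⟩
    exact ⟨x, hx, y, hφ, _, _, _, _, ⟨⟨⟨rfl, rfl⟩, rfl⟩, rfl⟩, rfl⟩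

/-- From a set of structures `str a I x y` one obtains the set of the corresponding `y`. -/
lemma exists_image_of_str (hS : N ⊨ Delta0Sep) {a I X : N} (P : N → N → Prop)
    (hX : ∀ z, z ε X ↔ ∃ x, x ε a ∧ ∃ y, P x y ∧ z = str a I x y) :
    ∃ b, ∀ y, y ε b ↔ ∃ x, x ε a ∧ P x y := by
  have two : ∀ {u w x : N}, u ε w → w ε x → u ε sUn x := fun h h' => by simpa using ⟨_, h', h⟩
  have fst : ∀ {u w x : N}, opair u w ε x → u ε sUn (sUn x) := fun {u w x} h =>
    two (by simp : u ε upair u u) (two (by simp [opair]) h)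
  have snd : ∀ {u w x : N}, opair u w ε x → w ε sUn (sUn x) := fun {u w x} h =>
    two (by simp : w ε upair u w) (two (by simp [opair]) h)
  -- The formula says `z = ⟨t, I⟩`, `t = ⟨q, r⟩` and `⟨y, y⟩ ∈ r` for some `z ∈ X`, so `y` is read
  -- off from the binary relation; the universe `a ∪ {y}` would not determine it when `y ∈ a`. Each
  -- unpacking of a pair costs two unions: `t ∈ ⋃²X` and `q, r ∈ ⋃⁴X`. One more union reaches `⟨y,
  -- y⟩`, and two more reach `y ∈ ⋃⁷X`.
  obtain ⟨b, hb⟩ := separation hS (k := 4)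
    (dex (Sum.inl (Sum.inl 0)) (dex (Sum.inl (Sum.inl 1)) (dPair (up new) new (Sum.inl (Sum.inl 2)) ⊓
      dex (Sum.inl (Sum.inl 3)) (dex (Sum.inl (Sum.inl 3)) (dPair (up (up new)) (up new) new ⊓
        dex new (dPair new (Sum.inl (Sum.inr 0)) (Sum.inl (Sum.inr 0))))))))
    ((((isDelta0_dPair _ _ _).inf ((((isDelta0_dPair _ _ _).inf
      ((isDelta0_dPair _ _ _).dex _)).dex _).dex _)).dex _).dex _)
    ![X, sUn (sUn X), I, sUn (sUn (sUn (sUn X)))] (sUn (sUn (sUn (sUn (sUn (sUn (sUn X)))))))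
  refine ⟨b, fun y => ?_⟩
  rw [hb, Formula.Realize]
  simp only [realize_dex, realize_dPair, BoundedFormula.realize_inf, elim_new, elim_up,
    Sum.elim_inl, Sum.elim_inr, Matrix.cons_val]
  constructor
  · rintro ⟨-, z, hz, t, -, rfl, q, -, r, -, rfl, w, hw, rfl⟩
    obtain ⟨x, hx, y', hP, h⟩ := (hX _).1 hz
    simp only [str, opair_inj] at h
    obtain ⟨⟨rfl, rfl⟩, -⟩ := h
    simp only [mem_sing, opair_inj, and_self] at hw
    subst hw
    exact ⟨x, hx, hP⟩
  · rintro ⟨x, hx, hP⟩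
    have h0 : str a I x y ε X := (hX _).2 ⟨x, hx, y, hP, rfl⟩
    have h1 := fst h0
    have h2 := snd h1
    exact ⟨snd (two (by simp : opair y y ε sing (opair y y)) h2), _, h0, _, h1, rfl, _,
      fst h1, _, h2, rfl, opair y y, by simp, rfl⟩

theorem replacement (hS : N ⊨ Delta0Sep) (hI : N ⊨ IndOmega) (hVP : N ⊨ VP) {k : ℕ}
    (φ : LSet.Formula (Fin k ⊕ Fin 2)) (p : Fin k → N)
    (hφ : ∀ x, ∃ y, φ.Realize (Sum.elim p ![x, y]) ∧
      ∀ z, φ.Realize (Sum.elim p ![x, z]) → z = y) (a : N) :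
    ∃ b, ∀ y, y ε b ↔ ∃ x, x ε a ∧ φ.Realize (Sum.elim p ![x, y]) := by
  obtain ⟨I, hid⟩ := exists_idOn hS a
  by_cases hX : ∃ X, ∀ z, z ε X ↔ (strClass φ).Realize default
      (Fin.snoc (Fin.snoc (Fin.snoc p a : Fin (k + 1) → N) I : Fin (k + 2) → N) z)
  · obtain ⟨X, hX⟩ := hX
    exact exists_image_of_str hS _ fun z => (hX z).trans (realize_strClass φ p a I z)
  · exfalso
    -- The language is `L_a`, with a constant for each element of `a`.
    obtain ⟨𝓜, 𝓝, h𝓜, h𝓝, hne, h⟩ := vopenka hI hVP _ _ a hX fun z hz => by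
      obtain ⟨x, hx, y, -, rfl⟩ := (realize_strClass φ p a I z).1 hz
      -- The universe `a ∪ {y}` holds the values of `I`, the element `x` of `U`, and the `y`
      -- occurring in `R`.
      refine ⟨_, _, _, _, rfl, ?_, ?_, ?_, ?_⟩
      · simp [hx]
      · simp
      · simp only [FunOn, hid, opair_inj]
        exact ⟨fun w ⟨x, hx, hw⟩ => ⟨x, hx, x, hw⟩,
          fun x hx => ⟨x, ⟨x, hx, rfl, rfl⟩, fun z ⟨_, _, h1, h2⟩ => by rw [h1, h2]⟩⟩
      · simp only [hid, opair_inj]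
        rintro x y ⟨_, hx, rfl, rfl⟩
        simp [hx]
    obtain ⟨x, hx, y, hxy, rfl⟩ := (realize_strClass φ p a I 𝓜).1 h𝓜
    obtain ⟨x', -, y', hxy', rfl⟩ := (realize_strClass φ p a I 𝓝).1 h𝓝
    -- `U(c_x)` holds in the first structure. In the second, the value `x` of `c_x` must then lie in
    -- `{x'}`.
    obtain ⟨z, hz, hxz⟩ := h x _ _ _ _ _ _ _ _ hx rfl rfl
      ⟨x, by simp, by simpa [hid] using hx⟩
    have : x = x' := by
      simp only [hid, opair_inj, mem_sing] at hxz hz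
      grind
    subst this
    -- Only here does it matter that `φ` is functional.
    obtain ⟨u, -, hu⟩ := hφ x
    exact hne (by rw [hu y hxy, hu y' hxy'])

lemma realize_axRep (hS : N ⊨ Delta0Sep) (hI : N ⊨ IndOmega) (hVP : N ⊨ VP) {k : ℕ}
    (φ : LSet.Formula (Fin k ⊕ Fin 2)) : N ⊨ axRep φ := by
  unfold axRep
  rw [Sentence.Realize, BoundedFormula.realize_alls]
  intro p
  simp only [realize_all', BoundedFormula.realize_imp, WeakSet.and, BoundedFormula.realize_inf,
    BoundedFormula.realize_iff, realize_exIn, realize_inst, Fin.snoc_castSucc, realize_ex',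
    realize_mem, realize_eq, Fin.snoc_last, comp_vec₂, snoc_comp_castSucc, snoc_comp_castSucc_self]
  exact replacement hS hI hVP φ p

/-! ### Separation from Replacement -/

/-- A formula `φ(p, x)`, seen as a formula in `p`, a further parameter, `x` and `y`. -/
def weaken {k : ℕ} (φ : LSet.Formula (Fin k ⊕ Fin 1)) : LSet.Formula (Fin (k + 1) ⊕ Fin 2) :=
  BoundedFormula.relabel (n := 0) (fun i => Sum.inl (Sum.map Fin.castSucc (fun _ => 0) i)) φ

/-- The graph of the function that maps `x` to `x` if `φ(p, x)`, and to the last parameter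
otherwise. -/
def sepGraph {k : ℕ} (φ : LSet.Formula (Fin k ⊕ Fin 1)) : LSet.Formula (Fin (k + 1) ⊕ Fin 2) :=
  (weaken φ ⊓ deq (Sum.inl (Sum.inr 1)) (Sum.inl (Sum.inr 0))) ⊔
  (∼(weaken φ) ⊓ deq (Sum.inl (Sum.inr 1)) (Sum.inl (Sum.inl (Fin.last k))))

omit [IsEST N] in
lemma realize_weaken {k : ℕ} (φ : LSet.Formula (Fin k ⊕ Fin 1)) (p : Fin k → N) (c x y : N) :
    (weaken φ).Realize (Sum.elim (Fin.snoc p c) ![x, y]) ↔ φ.Realize (Sum.elim p fun _ => x) := by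
  refine (BoundedFormula.realize_relabel (n := 0)).trans ?_
  refine iff_of_eq (congrArg₂ _ ?_ (Subsingleton.elim _ _))
  funext i
  rcases i with i | i <;> simp

omit [IsEST N] in
lemma realize_sepGraph {k : ℕ} (φ : LSet.Formula (Fin k ⊕ Fin 1)) (p : Fin k → N) (c x y : N) :
    (sepGraph φ).Realize (Sum.elim (Fin.snoc p c) ![x, y]) ↔
      (φ.Realize (Sum.elim p fun _ => x) ∧ y = x) ∨ (¬ φ.Realize (Sum.elim p fun _ => x) ∧ y = c) := by
  have h := realize_weaken φ p c x y
  unfold Formula.Realize at h ⊢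
  simp only [sepGraph, BoundedFormula.realize_sup, BoundedFormula.realize_inf,
    BoundedFormula.realize_not, h, realize_deq]
  simp

lemma realize_axSep (hS : N ⊨ Delta0Sep) (hI : N ⊨ IndOmega) (hVP : N ⊨ VP) {k : ℕ}
    (φ : LSet.Formula (Fin k ⊕ Fin 1)) : N ⊨ axSep φ := by
  unfold axSep
  rw [Sentence.Realize, BoundedFormula.realize_alls]
  intro p
  simp only [realize_all', BoundedFormula.realize_iff, WeakSet.and, BoundedFormula.realize_inf,
    realize_inst, Fin.snoc_castSucc, realize_ex', realize_mem, Fin.snoc_last, comp_vec₁,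
    snoc_comp_castSucc, snoc_comp_castSucc_self]
  intro a
  -- Replacement needs a function defined everywhere, so a default value is required for the `x`
  -- that fail `φ`. Any `c` already in the desired set is harmless; if there is none, that set is
  -- empty.
  by_cases hc : ∃ c, c ε a ∧ φ.Realize (Sum.elim p fun _ => c)
  · obtain ⟨c, hca, hc⟩ := hc
    obtain ⟨b, hb⟩ := replacement hS hI hVP (sepGraph φ) (Fin.snoc p c) (fun x => by
      simp only [realize_sepGraph]
      by_cases hx : φ.Realize (Sum.elim p fun _ => x) <;> simp [hx]) a
    refine ⟨b, fun x => (hb x).trans ?_⟩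
    simp only [realize_sepGraph]
    constructor
    · rintro ⟨y, hy, ⟨h, rfl⟩ | ⟨-, rfl⟩⟩
      exacts [⟨hy, h⟩, ⟨hca, hc⟩]
    · rintro ⟨hx, h⟩
      exact ⟨x, hx, Or.inl ⟨h, rfl⟩⟩
  · exact ⟨emp N, fun x => ⟨fun h => (not_mem_emp _ h).elim, fun h => (hc ⟨x, h⟩).elim⟩⟩

end Semantics

/-! ### From models to consequences of the theories -/

lemma isEST_of_models {N : Type*} [LSet.Structure N] (h : N ⊨ EST₀) : IsEST N where
  ext := by
    have := h.realize_of_mem axExt (by simp [EST₀])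
    simpa only [axExt, Sentence.Realize, Formula.Realize, realize_all', realize_ex',
      realize_allIn, realize_exIn, BoundedFormula.realize_imp, BoundedFormula.realize_iff,
      BoundedFormula.realize_not, WeakSet.and, WeakSet.or, BoundedFormula.realize_inf,
      BoundedFormula.realize_sup, realize_mem, realize_eq, Fin.snoc_castSucc, Fin.snoc_last] using this
  empty := by
    have := h.realize_of_mem axEmpty (by simp [EST₀])
    simpa only [axEmpty, isEmpty, Sentence.Realize, Formula.Realize, realize_all', realize_ex',
      realize_allIn, realize_exIn, BoundedFormula.realize_imp, BoundedFormula.realize_iff,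
      BoundedFormula.realize_not, WeakSet.and, WeakSet.or, BoundedFormula.realize_inf,
      BoundedFormula.realize_sup, realize_mem, realize_eq, Fin.snoc_castSucc, Fin.snoc_last] using this
  pair := by
    have := h.realize_of_mem axPair (by simp [EST₀])
    simpa only [axPair, isUPair, Sentence.Realize, Formula.Realize, realize_all', realize_ex',
      realize_allIn, realize_exIn, BoundedFormula.realize_imp, BoundedFormula.realize_iff,
      BoundedFormula.realize_not, WeakSet.and, WeakSet.or, BoundedFormula.realize_inf,
      BoundedFormula.realize_sup, realize_mem, realize_eq, Fin.snoc_castSucc, Fin.snoc_last] using this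
  union := by
    have := h.realize_of_mem axUnion (by simp [EST₀])
    simpa only [axUnion, Sentence.Realize, Formula.Realize, realize_all', realize_ex',
      realize_allIn, realize_exIn, BoundedFormula.realize_imp, BoundedFormula.realize_iff,
      BoundedFormula.realize_not, WeakSet.and, WeakSet.or, BoundedFormula.realize_inf,
      BoundedFormula.realize_sup, realize_mem, realize_eq, Fin.snoc_castSucc, Fin.snoc_last] using this
  prod := by
    have := h.realize_of_mem axCartProd (by simp [EST₀])
    simpa only [axCartProd, isProd, isPair, isUPair, Sentence.Realize, Formula.Realize, realize_all', realize_ex',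
      realize_allIn, realize_exIn, BoundedFormula.realize_imp, BoundedFormula.realize_iff,
      BoundedFormula.realize_not, WeakSet.and, WeakSet.or, BoundedFormula.realize_inf,
      BoundedFormula.realize_sup, realize_mem, realize_eq, Fin.snoc_castSucc, Fin.snoc_last] using this

lemma proves_rep_sep : Proves (EST ∪ VP) Rep ∧ Proves (EST ∪ VP) Sep := by
  have key : ∀ M : Theory.ModelType.{0, 0, 0} (EST ∪ VP),
      IsEST M ∧ (M ⊨ Delta0Sep) ∧ (M ⊨ IndOmega) ∧ (M ⊨ VP) := fun M => by
    have h : M ⊨ EST ∪ VP := M.is_model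
    exact ⟨isEST_of_models (h.mono fun _ hx => Or.inl (Or.inl hx)),
      h.mono fun _ hx => Or.inl (Or.inl (Or.inr hx)), h.mono fun _ hx => Or.inl (Or.inr hx),
      h.mono fun _ hx => Or.inr hx⟩
  constructor
  · rintro _ ⟨k, φ, rfl⟩
    refine Theory.models_sentence_iff.2 fun M => ?_
    obtain ⟨_, hS, hI, hVP⟩ := key M
    exact realize_axRep hS hI hVP φ
  · rintro _ ⟨k, φ, rfl⟩
    refine Theory.models_sentence_iff.2 fun M => ?_
    obtain ⟨_, hS, hI, hVP⟩ := key M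
    exact realize_axSep hS hI hVP φ

lemma Proves.mono {T T' S S' : LSet.Theory} (h : Proves T S) (hT : T ⊆ T') (hS : S' ⊆ S) :
    Proves T' S' := fun σ hσ => Theory.models_sentence_iff.2 fun M =>
  Theory.models_sentence_iff.1 (h σ (hS hσ)) (M.subtheoryModel hT)

end WeakSet

theorem mainTheorem2 :
    WeakSet.Proves (WeakSet.EST ∪ WeakSet.VP) WeakSet.Delta0Rep ∧
    WeakSet.Proves (WeakSet.EST ∪ WeakSet.VP ∪ WeakSet.Delta0Rep) WeakSet.Rep ∧
    WeakSet.Proves (WeakSet.EST ∪ WeakSet.VP) WeakSet.Rep ∧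
    WeakSet.Proves (WeakSet.EST ∪ WeakSet.VP) WeakSet.Sep := by
  obtain ⟨hR, hS⟩ := WeakSet.proves_rep_sep
  -- The first claim proves fewer instances than full Replacement, and the second proves the same
  -- instances from more axioms.
  refine ⟨hR.mono subset_rfl ?_, hR.mono Set.subset_union_left subset_rfl, hR, hS⟩
  rintro _ ⟨k, φ, -, rfl⟩
  exact ⟨k, φ, rfl⟩
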